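/- Let $(\mathbb X,\mathcal X)$ be a standard Borel space and let $\mathbf N$ be the set of $\sigma$-finite counting measures on $\mathbb X$ (that is, $\sigma$-finite measures with values in $\{0,1,2,\dots\}\cup\{\infty\}$), with the smallest $\sigma$-algebra making all maps $\mu\mapsto\mu(A)$, $A\in\mathcal X$, measurable. For each $s>0$ let $\eta_s$ be a Poisson process on $\mathbb X$ with $\sigma$-finite intensity measure $\lambda_s$, let $f_s:\mathbb X\times\mathbf N\to\mathbb R$ be measurable, and suppose that the sum of scores $$F_s=F_s(\eta_s)=\sum_{x\in\eta_s} f_s(x,\eta_s)$$ (points counted with multiplicity, i.e. $F_s(\mu)=\int f_s(x,\mu)\,\mu(dx)$) converges absolutely almost surely and is square-integrable. Write $D_yG(\mu)=G(\mu+\delta_y)-G(\mu)$, and let $$T_s=\int_{\mathbb X^2}\mathbb E\big[f_s(x,\eta_s+\delta_x+\delta_y)\,f_s(y,\eta_s+\delta_x+\delta_y)\big]\,\lambda_s^2(dx,dy)-\int_{\mathbb X^2}\mathbb E[f_s(x,\eta_s+\delta_x)]\,\mathbb E[f_s(y,\eta_s+\delta_y)]\,\lambda_s^2(dx,dy).$$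 **(A1)** There is a constant $C\in(0,\infty)$ such that, for all $s>0$, $f_s(x,\eta_s+\delta_x+\delta_y)f_s(y,\eta_s+\delta_x+\delta_y)$ is integrable with respect to $\mathbb P\otimes\lambda_s^2$ (so that $T_s$ is well defined) and $$T_s\le C\int_{\mathbb X}\mathbb E[f_s(x,\eta_s+\delta_x)^2]\,\lambda_s(dx).$$ **(A2)** There are $\varepsilon_s\ge 0$ with $\varepsilon_s\to0$ as $s\to\infty$ such that, for all $s>0$ and $\lambda_s$-almost every $y\in\mathbb X$, $$\mathbb E[f_s(y,\eta_s+\delta_y)^2]\le\varepsilon_s\,\mathbb E\Big[\Big(\sum_{x\in\eta_s}D_yf_s(x,\eta_s)\Big)^2\Big].$$ If (A1) holds, then $$\operatorname{Var}(F_s)=\mathcal O\Big(\int_{\mathbb X}\mathbb E[f_s(y,\eta_s+\delta_y)^2]\,\lambda_s(dy)\Big),$$ i.e. there is a constant $K\in(0,\infty)$ such that, for all $s>0$, $\operatorname{Var}(F_s)$ is at most $K$ times the integral. If moreover (A2) holds, then $F_s$ is $(1+C)\varepsilon_s/(1-\sqrt{\varepsilon_s})^2$-superconcentrated, with $C$ as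 in (A1): this rate tends to $0$ as $s\to\infty$, and for every $s>0$ with $\varepsilon_s<1$ (in particular for all sufficiently large $s$), $$\operatorname{Var}(F_s)\le\frac{(1+C)\,\varepsilon_s}{(1-\sqrt{\varepsilon_s})^2}\;\mathbb E\int_{\mathbb X}(D_xF_s(\eta_s))^2\,\lambda_s(dx).$$ -/

import Mathlib

open MeasureTheory ProbabilityTheory Filter Topology
open scoped ENNReal

namespace PoissonScores

/-- The space `N` of configurations: the σ-finite counting measures on `X`, i.e. the σ-finite
measures all of whose values on measurable sets lie in `{0, 1, 2, …} ∪ {∞}`. Points may carry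
multiplicities. -/
def Config (X : Type*) [MeasurableSpace X] : Type _ :=
  {μ : Measure X // SigmaFinite μ ∧ ∀ A : Set X, MeasurableSet A → ∃ n : ℕ∞, μ A = (n : ℝ≥0∞)}

/-- The smallest σ-algebra on configurations for which all the maps `μ ↦ μ A`, `A` measurable,
are measurable (Mathlib's σ-algebra on `Measure X` is the one generated by these evaluations;
this is its trace). -/
instance Config.instMeasurableSpace (X : Type*) [MeasurableSpace X] :
    MeasurableSpace (Config X) :=
  MeasurableSpace.comap Subtype.val Measure.instMeasurableSpace

/-- The counting measure underlying a configuration. -/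
def Config.toMeasure {X : Type*} [MeasurableSpace X] (μ : Config X) : Measure X := μ.1

/-- The configuration `μ + δ_x`. -/
noncomputable def Config.add {X : Type*} [MeasurableSpace X] (μ : Config X) (x : X) : Config X :=
  ⟨μ.toMeasure + Measure.dirac x, by
    obtain ⟨μ, hσ, hμ⟩ := μ
    refine ⟨?_, fun A hA => ?_⟩
    · have : SigmaFinite μ := hσ
      exact inferInstanceAs (SigmaFinite (μ + Measure.dirac x))
    · obtain ⟨n, hn⟩ := hμ A hA
      by_cases hx : x ∈ A
      · exact ⟨n + 1, by simp [Config.toMeasure, hn, Measure.dirac_apply' x hA, hx]⟩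
      · exact ⟨n, by simp [Config.toMeasure, hn, Measure.dirac_apply' x hA, hx]⟩⟩

/-- `η` is a Poisson process on `X` with intensity measure `lam`: a random configuration whose
number of points in a measurable set `A` is Poisson distributed with parameter `lam A`
(and is almost surely infinite if `lam A = ∞`), and whose numbers of points in pairwise disjoint
measurable sets are independent. -/
structure IsPoissonProcess {Ω X : Type*} [MeasurableSpace Ω] [MeasurableSpace X]
    (P : Measure Ω) (η : Ω → Config X) (lam : Measure X) : Prop where
  measurable : Measurable η
  map_count : ∀ A : Set X, MeasurableSet A → lam A ≠ ∞ →
    P.map (fun ω => (η ω).toMeasure A) =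
      (poissonMeasure (lam A).toNNReal).map (fun k : ℕ => (k : ℝ≥0∞))
  count_eq_top : ∀ A : Set X, MeasurableSet A → lam A = ∞ → ∀ᵐ ω ∂P, (η ω).toMeasure A = ∞
  indep : ∀ (n : ℕ) (A : Fin n → Set X), (∀ i, MeasurableSet (A i)) →
    Pairwise (Function.onFun Disjoint A) →
    iIndepFun (fun i ω => (η ω).toMeasure (A i)) P

/-- The add-one cost `D_x F(μ) = F(μ + δ_x) - F(μ)`. -/
noncomputable def addOneCost {X : Type*} [MeasurableSpace X] (F : Config X → ℝ) (x : X)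
    (μ : Config X) : ℝ :=
  F (μ.add x) - F μ

/-- `∑_{x ∈ μ} g x`, the sum over the points of `μ` counted with multiplicity, that is, the
integral of `g` against the counting measure `μ`. The sum converges (absolutely) exactly when
`g` is integrable with respect to `μ`. -/
noncomputable def sumOver {X : Type*} [MeasurableSpace X] (μ : Config X) (g : X → ℝ) : ℝ :=
  ∫ x, g x ∂μ.toMeasure

/-- The sum of scores `F(μ) = ∑_{x ∈ μ} f(x, μ)`. -/
noncomputable def scoreSum {X : Type*} [MeasurableSpace X] (f : X → Config X → ℝ)
    (μ : Config X) : ℝ :=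
  sumOver μ (fun x => f x μ)

/-- `∫ E[f(x, η + δ_x)²] lam(dx)`, with value in `[0, ∞]`. -/
noncomputable def scoreSecondMoment {Ω X : Type*} [MeasurableSpace Ω] [MeasurableSpace X]
    (P : Measure Ω) (η : Ω → Config X) (lam : Measure X) (f : X → Config X → ℝ) : ℝ≥0∞ :=
  ∫⁻ x, ∫⁻ ω, ENNReal.ofReal ((f x ((η ω).add x)) ^ 2) ∂P ∂lam

/-- `f(x, μ + δ_x + δ_y) f(y, μ + δ_x + δ_y)`. -/
noncomputable def scoreProduct {X : Type*} [MeasurableSpace X] (f : X → Config X → ℝ)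
    (μ : Config X) (x y : X) : ℝ :=
  f x ((μ.add x).add y) * f y ((μ.add x).add y)

/-- The quantity `T`:
`∫∫ E[f(x, η + δ_x + δ_y) f(y, η + δ_x + δ_y)] lam²(d(x, y))
  - ∫∫ E[f(x, η + δ_x)] E[f(y, η + δ_y)] lam²(d(x, y))`. -/
noncomputable def pairTerm {Ω X : Type*} [MeasurableSpace Ω] [MeasurableSpace X]
    (P : Measure Ω) (η : Ω → Config X) (lam : Measure X) (f : X → Config X → ℝ) : ℝ :=
  (∫ p : X × X, (∫ ω, scoreProduct f (η ω) p.1 p.2 ∂P) ∂(lam.prod lam)) -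
    ∫ p : X × X, (∫ ω, f p.1 ((η ω).add p.1) ∂P) * (∫ ω, f p.2 ((η ω).add p.2) ∂P)
      ∂(lam.prod lam)

/-- Assumption (A1) with constant `C`: for all `s > 0`, the quantity `T_s` is well defined (the
first of its integrals converges absolutely; for a square-integrable absolutely convergent sum of
scores, this entails the absolute convergence of the second) and
`T_s ≤ C ∫ E[f_s(x, η_s + δ_x)²] lam_s(dx)`. -/
structure AssumptionA1 {Ω X : Type*} [MeasurableSpace Ω] [MeasurableSpace X]
    (P : Measure Ω) (η : ℝ → Ω → Config X) (lam : ℝ → Measure X)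
    (f : ℝ → X → Config X → ℝ) (C : ℝ) : Prop where
  pos : 0 < C
  integrable : ∀ s : ℝ, 0 < s →
    Integrable (fun q : Ω × (X × X) => scoreProduct (f s) (η s q.1) q.2.1 q.2.2)
      (P.prod ((lam s).prod (lam s)))
  le : ∀ s : ℝ, 0 < s →
    ENNReal.ofReal (pairTerm P (η s) (lam s) (f s)) ≤
      ENNReal.ofReal C * scoreSecondMoment P (η s) (lam s) (f s)

/-- Assumption (A2) with the function `ε`: `ε_s → 0` as `s → ∞` and, for all `s > 0` and
`lam_s`-almost every `y`,
`E[f_s(y, η_s + δ_y)²] ≤ ε_s E[(∑_{x ∈ η_s} D_y f_s(x, η_s))²]`. -/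
structure AssumptionA2 {Ω X : Type*} [MeasurableSpace Ω] [MeasurableSpace X]
    (P : Measure Ω) (η : ℝ → Ω → Config X) (lam : ℝ → Measure X)
    (f : ℝ → X → Config X → ℝ) (ε : ℝ → ℝ) : Prop where
  nonneg : ∀ s : ℝ, 0 < s → 0 ≤ ε s
  tendsto : Tendsto ε atTop (𝓝 0)
  le : ∀ s : ℝ, 0 < s → ∀ᵐ y ∂(lam s),
    ∫⁻ ω, ENNReal.ofReal ((f s y ((η s ω).add y)) ^ 2) ∂P ≤
      ENNReal.ofReal (ε s) *
        ∫⁻ ω, ENNReal.ofReal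
          ((sumOver (η s ω) (fun x => addOneCost (f s x) y (η s ω))) ^ 2) ∂P

/-- The family of square-integrable functionals `F_s(η_s)`, with parameter `s` ranging over a
set `S` that contains all sufficiently large reals, is `rate_s`-superconcentrated: `rate_s → 0`
as `s → ∞` and `Var F_s(η_s) ≤ rate_s E ∫ (D_x F_s(η_s))² lam_s(dx)` for all `s ∈ S`. -/
structure IsSuperconcentrated {Ω X : Type*} [MeasurableSpace Ω] [MeasurableSpace X]
    (P : Measure Ω) (η : ℝ → Ω → Config X) (lam : ℝ → Measure X)
    (F : ℝ → Config X → ℝ) (S : Set ℝ) (rate : ℝ → ℝ) : Prop where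
  mem_atTop : S ∈ (atTop : Filter ℝ)
  memLp : ∀ s ∈ S, MemLp (fun ω => F s (η s ω)) 2 P
  tendsto : Tendsto rate atTop (𝓝 0)
  le : ∀ s ∈ S,
    evariance (fun ω => F s (η s ω)) P ≤
      ENNReal.ofReal (rate s) *
        ∫⁻ ω, ∫⁻ x, ENNReal.ofReal ((addOneCost (F s) x (η s ω)) ^ 2) ∂(lam s) ∂P

end PoissonScores

/-!
Write `F(η) = ∑_{x ∈ η} f(x, η)`. The proof computes the variance of `F` exactly and compares it
with the add-one costs of `F`.

*Mecke equations.* The equation `E ∑_{x ∈ η} g(η, x) = ∫ E g(η + δ_x, x) lam(dx)` is derived from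
the definition of a Poisson process. For an indicator `g` of a rectangle `E × B`, where `E`
prescribes the numbers of points in finitely many sets, these sets and `B` are cut into disjoint
atoms, and independence reduces the claim to the identity `E[N h(N)] = r E[h(N + 1)]` for a Poisson
variable `N` of mean `r` (`lintegral_mul_of_map_eq_poisson`, `IsPoissonProcess.mecke_cylinder`). A
π-λ argument gives equality of the corresponding measures (`IsPoissonProcess.satisfiesMecke`), and a
second application the equation for pairs of points (`SatisfiesMecke.compProd_prod_eq`), whose two
terms come from the pairs `(x, x)` and from the pairs of distinct points. Integration against a
configuration is measurable in the configuration because almost surely each cell of a fixed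
countable partition contains finitely many points, so that `μ ↦ μ` may be replaced by the s-finite
kernel `pointKernel`.

*Variance.* The equation for pairs, applied to `f(x, μ) f(y, μ)`, gives
`Var F = ∫ E f(x, η + δ_x)² lam(dx) + T`, with `T` the `pairTerm` (`SatisfiesMecke.variance_eq`),
once the first integral is known to be finite. That follows from the integrability in
`AssumptionA1`: the square of `F` is integrable, and so is the contribution of distinct points,
hence also their difference. A truncation of the scores makes this rigorous
(`SatisfiesMecke.integrable_sq`). With `T ≤ C ∫ E f²` the first claim
follows with `K = 1 + C`.

*Superconcentration.* The add-one cost is `D_y F = f(y, η + δ_y) + ∑_{x ∈ η} D_y f(x, η)`. By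
`AssumptionA2` the `L²` norm of the first summand is at most `√ε` times that of the second, so
Minkowski's inequality gives `E f(y, η + δ_y)² ≤ ε / (1 - √ε)² E (D_y F)²`
(`IsPoissonProcess.scoreSecondMoment_le`). This uses that the left side is finite for almost every
`y`, which the variance argument provides. Integration over `y` and the bound
`Var F ≤ (1 + C) ∫ E f²` conclude.
-/

namespace PoissonScores

/-! ### Counting measures and the Mecke equation on rectangles -/

section

variable {Ω X : Type*} [MeasurableSpace Ω] [MeasurableSpace X]

lemma Config.measurable_toMeasure : Measurable (Config.toMeasure (X := X)) :=
  comap_measurable _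

lemma Config.measurable_apply {A : Set X} (hA : MeasurableSet A) :
    Measurable fun μ : Config X => μ.toMeasure A :=
  (Measure.measurable_coe hA).comp Config.measurable_toMeasure

lemma Config.measurable_of_apply {β : Type*} [MeasurableSpace β] {g : β → Config X}
    (h : ∀ A, MeasurableSet A → Measurable fun b => (g b).toMeasure A) : Measurable g := by
  refine measurable_comap_iff.2 ?_
  exact Measure.measurable_of_measurable_coe _ h

lemma Config.measurable_add : Measurable fun p : Config X × X => p.1.add p.2 := by
  refine Config.measurable_of_apply fun A hA => ?_
  have h : (fun p : Config X × X => (p.1.add p.2).toMeasure A) =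
      fun p => p.1.toMeasure A + A.indicator 1 p.2 := by
    ext p
    simp [Config.add, Config.toMeasure, Measure.dirac_apply' _ hA]
  rw [h]
  exact ((Config.measurable_apply hA).comp measurable_fst).add
    ((measurable_one.indicator hA).comp measurable_snd)

lemma Config.toMeasure_add (μ : Config X) (x : X) :
    (μ.add x).toMeasure = μ.toMeasure + Measure.dirac x := rfl

lemma Config.toMeasure_add_apply (μ : Config X) (x : X) {A : Set X} (hA : MeasurableSet A) :
    (μ.add x).toMeasure A = μ.toMeasure A + A.indicator 1 x := by
  simp [Config.toMeasure_add, Measure.dirac_apply' _ hA]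

/-- The events of the form `{μ | μ A₁ ∈ S₁, …, μ Aₙ ∈ Sₙ}`. -/
def Config.cylinders (X : Type*) [MeasurableSpace X] : Set (Set (Config X)) :=
  piiUnionInter (fun A : {A : Set X // MeasurableSet A} =>
    {S | MeasurableSet[MeasurableSpace.comap (fun μ : Config X => μ.toMeasure A.1)
      inferInstance] S}) Set.univ

lemma Config.isPiSystem_cylinders : IsPiSystem (Config.cylinders X) :=
  isPiSystem_piiUnionInter (fun A : {A : Set X // MeasurableSet A} =>
    {S | MeasurableSet[MeasurableSpace.comap (fun μ : Config X => μ.toMeasure A.1)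
      inferInstance] S}) (fun A => @MeasurableSpace.isPiSystem_measurableSet _
    (MeasurableSpace.comap (fun μ : Config X => μ.toMeasure A.1) inferInstance)) _

lemma Config.generateFrom_cylinders :
    Config.instMeasurableSpace X = MeasurableSpace.generateFrom (Config.cylinders X) := by
  rw [Config.cylinders, generateFrom_piiUnionInter_measurableSet
    (fun A : {A : Set X // MeasurableSet A} =>
      MeasurableSpace.comap (fun μ : Config X => μ.toMeasure A.1) inferInstance)]
  refine le_antisymm (Measurable.comap_le (Measure.measurable_of_measurable_coe _ fun A hA => ?_))
    (iSup₂_le fun A _ => (Config.measurable_apply A.2).comap_le)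
  exact Measurable.of_comap_le (le_iSup₂_of_le (⟨A, hA⟩ : {A : Set X // MeasurableSet A})
    (Set.mem_univ _) le_rfl)

lemma Config.exists_of_mem_cylinders {E : Set (Config X)} (hE : E ∈ Config.cylinders X) :
    ∃ (t : Finset (Set X)) (S : Set X → Set ℝ≥0∞), (∀ A ∈ t, MeasurableSet A) ∧
      (∀ A, MeasurableSet (S A)) ∧ E = {μ | ∀ A ∈ t, μ.toMeasure A ∈ S A} := by
  classical
  obtain ⟨t, -, g, hg, rfl⟩ := hE
  choose! S hS hSg using hg
  refine ⟨t.image Subtype.val, fun A =>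
    if h : ∃ hA : MeasurableSet A, (⟨A, hA⟩ : {A : Set X // MeasurableSet A}) ∈ t
    then S ⟨A, h.choose⟩ else Set.univ, ?_, ?_, ?_⟩
  · intro A hA
    obtain ⟨B, -, rfl⟩ := Finset.mem_image.1 hA
    exact B.2
  · intro A
    dsimp only
    split_ifs with h
    · exact hS _ h.choose_spec
    · exact MeasurableSet.univ
  · ext μ
    simp only [Set.mem_iInter, Finset.mem_image, Set.mem_ofPred_eq]
    constructor
    · rintro h A ⟨B, hB, rfl⟩
      have hex : ∃ hA : MeasurableSet B.1,
          (⟨B.1, hA⟩ : {A : Set X // MeasurableSet A}) ∈ t := ⟨B.2, hB⟩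
      rw [dif_pos hex]
      have := h B hB
      rw [← hSg B hB] at this
      exact this
    · intro h B hB
      have hex : ∃ hA : MeasurableSet B.1,
          (⟨B.1, hA⟩ : {A : Set X // MeasurableSet A}) ∈ t := ⟨B.2, hB⟩
      have := h B.1 ⟨B, hB, rfl⟩
      rw [dif_pos hex] at this
      rw [← hSg B hB]
      exact this

lemma lintegral_poissonMeasure_mul (r : NNReal) (g : ℕ → ℝ≥0∞) :
    ∫⁻ n, n * g n ∂(poissonMeasure r) = r * ∫⁻ n, g (n + 1) ∂(poissonMeasure r) := by
  simp only [poissonMeasure, lintegral_sum_measure, lintegral_smul_measure, lintegral_dirac,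
    smul_eq_mul]
  rw [tsum_eq_zero_add' ENNReal.summable, ← ENNReal.tsum_mul_left]
  simp only [Nat.cast_zero, zero_mul, mul_zero, zero_add]
  congr 1 with n
  have : ENNReal.ofReal (Real.exp (-r) * r ^ (n + 1) / (n + 1).factorial) * ((n + 1 : ℕ) : ℝ≥0∞) =
      r * ENNReal.ofReal (Real.exp (-r) * r ^ n / n.factorial) := by
    rw [← ENNReal.ofReal_natCast, ← ENNReal.ofReal_coe_nnreal, ← ENNReal.ofReal_mul (by positivity),
      ← ENNReal.ofReal_mul (by positivity)]
    congr 1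
    rw [Nat.factorial_succ]
    push_cast
    field_simp
    ring
  rw [← mul_assoc, this, mul_assoc]

/-- The Chen–Stein identity for a Poisson variable `N`, with an independent parameter `Z`. -/
lemma lintegral_mul_of_map_eq_poisson {P : Measure Ω} [IsProbabilityMeasure P] {β : Type*}
    [MeasurableSpace β] {N : Ω → ℝ≥0∞} {Z : Ω → β} (hN : Measurable N) (hZ : Measurable Z)
    {r : NNReal} (hlaw : P.map N = (poissonMeasure r).map (fun k : ℕ => (k : ℝ≥0∞)))
    (hind : IndepFun N Z P) {h : ℝ≥0∞ × β → ℝ≥0∞} (hh : Measurable h) :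
    ∫⁻ ω, N ω * h (N ω, Z ω) ∂P = r * ∫⁻ ω, h (N ω + 1, Z ω) ∂P := by
  have key := (indepFun_iff_map_prod_eq_prod_map_map hN.aemeasurable hZ.aemeasurable).1 hind
  have : IsProbabilityMeasure (P.map Z) := Measure.isProbabilityMeasure_map hZ.aemeasurable
  have e (g : ℝ≥0∞ × β → ℝ≥0∞) (hg : Measurable g) : ∫⁻ ω, g (N ω, Z ω) ∂P =
      ∫⁻ z, ∫⁻ n : ℕ, g (n, z) ∂(poissonMeasure r) ∂(P.map Z) := by
    rw [← lintegral_map (f := g) (g := fun ω => (N ω, Z ω)) hg (hN.prodMk hZ), key, hlaw,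
      lintegral_prod_symm' _ hg]
    congr 1 with z
    rw [lintegral_map (by fun_prop) .of_discrete]
  rw [e (fun p => p.1 * h p) (by fun_prop), e (fun p => h (p.1 + 1, p.2)) (by fun_prop),
    ← lintegral_const_mul]
  · congr 1 with z
    rw [lintegral_poissonMeasure_mul r (fun n => h (n, z))]
    simp
  · exact Measurable.lintegral_prod_left' (f := fun p : ℕ × β => h ((p.1 : ℝ≥0∞) + 1, p.2))
      (hh.comp ((((Measurable.of_discrete (f := fun n : ℕ => (n : ℝ≥0∞))).comp
        measurable_fst).add measurable_const).prodMk measurable_snd))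

variable {P : Measure Ω} [IsProbabilityMeasure P] {η : Ω → Config X} {lam : Measure X}

omit [IsProbabilityMeasure P] in
lemma IsPoissonProcess.iIndepFun_count (hη : IsPoissonProcess P η lam) {ι : Type*} [Finite ι]
    {A : ι → Set X} (hA : ∀ i, MeasurableSet (A i)) (hd : Pairwise (Function.onFun Disjoint A)) :
    iIndepFun (fun i ω => (η ω).toMeasure (A i)) P := by
  obtain ⟨n, ⟨e⟩⟩ := Finite.exists_equiv_fin ι
  have := hη.indep n (A ∘ e.symm) (fun i => hA _) (hd.comp_of_injective e.symm.injective)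
  simpa using this.precomp e.injective

/-- The Mecke equation for a function of the numbers of points in disjoint sets, one of which is
`A j`. Only the intensity of `A j` has to be finite: of the other counts just the independence
matters. -/
lemma IsPoissonProcess.lintegral_count_mul (hη : IsPoissonProcess P η lam) {ι : Type*} [Finite ι]
    {A : ι → Set X} (hA : ∀ i, MeasurableSet (A i)) (hd : Pairwise (Function.onFun Disjoint A))
    (j : ι) [DecidableEq ι] (hj : lam (A j) ≠ ∞) {h : (ι → ℝ≥0∞) → ℝ≥0∞} (hh : Measurable h) :
    ∫⁻ ω, (η ω).toMeasure (A j) * h (fun i => (η ω).toMeasure (A i)) ∂P =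
      lam (A j) * ∫⁻ ω, h (fun i => (η ω).toMeasure (A i) + if i = j then 1 else 0) ∂P := by
  have := Fintype.ofFinite ι
  have hm (i : ι) : Measurable fun ω => (η ω).toMeasure (A i) :=
    (Config.measurable_apply (hA i)).comp hη.measurable
  have hI := (hη.iIndepFun_count hA hd).indepFun_finset {j} (Finset.univ.erase j)
    (by simp) hm
  have hφ : Measurable fun z : ({j} : Finset ι) → ℝ≥0∞ => z ⟨j, Finset.mem_singleton_self j⟩ :=
    measurable_pi_apply _
  have hI' := hI.comp hφ measurable_id
  let merge : ℝ≥0∞ × (↥(Finset.univ.erase j) → ℝ≥0∞) → (ι → ℝ≥0∞) :=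
    fun p i => if hi : i = j then p.1 else p.2 ⟨i, by simp [hi]⟩
  have hmerge : Measurable merge := by
    refine measurable_pi_lambda _ fun i => ?_
    by_cases hi : i = j
    · simp only [merge, hi, dif_pos]; fun_prop
    · simp only [merge, hi, dif_neg, not_false_iff]; fun_prop
  have key := lintegral_mul_of_map_eq_poisson (hm j)
    (measurable_pi_lambda _ fun i : ↥(Finset.univ.erase j) => hm i.1)
    (hη.map_count _ (hA j) hj) hI' (hh.comp hmerge)
  rw [ENNReal.coe_toNNReal hj] at key
  convert key using 4 with ω ω
  · simp only [Function.comp]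
    congr 1
    ext i
    by_cases hi : i = j <;> simp [merge, hi]
  · simp only [Function.comp]
    congr 1
    ext i
    by_cases hi : i = j <;> simp [merge, hi]

/-- The Mecke equation on a rectangle `B × E`, with `E` a cylinder event. The sets describing `E`
and `B` are cut into the atoms of the algebra that they generate. -/
lemma IsPoissonProcess.mecke_cylinder (hη : IsPoissonProcess P η lam) {B : Set X}
    (hB : MeasurableSet B) (hfin : lam B ≠ ∞) {E : Set (Config X)} (hE : E ∈ Config.cylinders X) :
    ∫⁻ ω, (η ω).toMeasure B * E.indicator 1 (η ω) ∂P =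
      ∫⁻ x in B, ∫⁻ ω, E.indicator 1 ((η ω).add x) ∂P ∂lam := by
  classical
  obtain ⟨t, S, ht, hS, rfl⟩ := Config.exists_of_mem_cylinders hE
  let t' : Finset (Set X) := insert B t
  have ht' (A : t') : MeasurableSet A.1 := by
    rcases Finset.mem_insert.1 A.2 with h | h
    · rw [h]; exact hB
    · exact ht _ h
  -- `pat x` records which of the sets contain `x`; its level sets `a p` are the atoms.
  let pat : X → Set t' := fun x => {A | x ∈ A.1}
  let a : Set t' → Set X := fun p => pat ⁻¹' {p}
  have ha (p) : MeasurableSet (a p) := by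
    have : a p = ⋂ A : t', if A ∈ p then A.1 else A.1ᶜ := by
      ext x
      simp only [a, pat, Set.mem_preimage, Set.mem_singleton_iff, Set.mem_iInter, Set.ext_iff,
        Set.mem_ofPred_eq]
      refine forall_congr' fun A => ?_
      split_ifs with h <;> simp [h]
    rw [this]
    refine MeasurableSet.iInter fun A => ?_
    split_ifs
    · exact ht' A
    · exact (ht' A).compl
  have hd : Pairwise (Function.onFun Disjoint a) := fun p q hpq =>
    Disjoint.preimage _ (by simpa using hpq)
  have hunion (A : t') : A.1 = ⋃ p ∈ Finset.univ.filter (fun p : Set t' => A ∈ p), a p := by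
    ext x
    simp [a, pat]
  have hsum (ν : Measure X) (A : t') :
      ν A.1 = ∑ p ∈ Finset.univ.filter (fun p : Set t' => A ∈ p), ν (a p) := by
    conv_lhs => rw [hunion A]
    exact measure_biUnion_finset (fun p _ q _ hpq => hd hpq) (fun p _ => ha p)
  let b : t' := ⟨B, Finset.mem_insert_self _ _⟩
  let h : (Set t' → ℝ≥0∞) → ℝ≥0∞ := Set.indicator
    {z | ∀ A : t', A.1 ∈ t → ∑ p ∈ Finset.univ.filter (fun p : Set t' => A ∈ p), z p ∈ S A.1} 1
  have hh : Measurable h := by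
    refine measurable_one.indicator ?_
    rw [Set.ofPred_forall]
    refine MeasurableSet.iInter fun A => ?_
    rw [Set.ofPred_forall]
    refine MeasurableSet.iInter fun _ => ?_
    exact (Finset.measurable_sum _ fun p _ => measurable_pi_apply p) (hS _)
  -- Adding the point `x` changes only the count of the atom of `x`, so the event is rephrased
  -- in terms of the counts of the atoms.
  have hind (μ : Config X) : Set.indicator {μ : Config X | ∀ A ∈ t, μ.toMeasure A ∈ S A} 1 μ =
      h (fun p => μ.toMeasure (a p)) := by
    simp only [h, Set.indicator_apply, Set.mem_ofPred_eq, ← hsum]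
    congr 1
    refine propext ⟨fun H A hA => H _ hA, fun H A hA => H ⟨A, Finset.mem_insert_of_mem hA⟩ hA⟩
  have hm : Measurable fun ω => h (fun p => (η ω).toMeasure (a p)) := hh.comp
    (measurable_pi_lambda _ fun p => (Config.measurable_apply (ha p)).comp hη.measurable)
  simp only [hind]
  have hl (ω) : (η ω).toMeasure B * h (fun p => (η ω).toMeasure (a p)) =
      ∑ p ∈ Finset.univ.filter (fun p : Set t' => b ∈ p),
        (η ω).toMeasure (a p) * h (fun p => (η ω).toMeasure (a p)) := by
    rw [← Finset.sum_mul, ← hsum _ b]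
  simp only [hl]
  rw [lintegral_finsetSum (f := fun p ω => (η ω).toMeasure (a p) * h fun p => (η ω).toMeasure (a p))
    _ (fun p _ => ((Config.measurable_apply (ha p)).comp hη.measurable).mul hm)]
  conv_rhs => rw [show B = b.1 from rfl, hunion b]
  rw [lintegral_biUnion_finset (fun p _ q _ hpq => hd hpq) (fun p _ => ha p)]
  refine Finset.sum_congr rfl fun p hp => ?_
  -- The atoms with `b ∈ p` are contained in `B`.
  have hle : lam (a p) ≠ ∞ := by
    refine ne_top_of_le_ne_top hfin (measure_mono fun x hx => ?_)
    have h1 : pat x = p := hx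
    have h2 : b ∈ p := (Finset.mem_filter.1 hp).2
    rw [← h1] at h2
    exact h2
  rw [hη.lintegral_count_mul ha hd p hle hh]
  rw [setLIntegral_congr_fun (g := fun _ => ∫⁻ ω, h (fun q => (η ω).toMeasure (a q) +
    if q = p then 1 else 0) ∂P) (ha p)]
  · rw [setLIntegral_const, mul_comm]
  · intro x hx
    have hx' : pat x = p := hx
    simp only [Config.toMeasure_add_apply _ _ (ha _)]
    congr 1 with ω
    congr 1
    ext q
    simp [a, Set.indicator_apply, hx', eq_comm]

lemma IsPoissonProcess.lintegral_count (hη : IsPoissonProcess P η lam) {B : Set X}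
    (hB : MeasurableSet B) (hfin : lam B ≠ ∞) :
    ∫⁻ ω, (η ω).toMeasure B ∂P = lam B := by
  have := hη.lintegral_count_mul (ι := Unit) (A := fun _ => B) (fun _ => hB)
    (fun i j hij => absurd (Subsingleton.elim i j) hij) () hfin (h := fun _ => 1) measurable_const
  simpa using this

/-- The Mecke equation on a rectangle `B × E`. -/
lemma IsPoissonProcess.mecke_rectangle (hη : IsPoissonProcess P η lam) {B : Set X}
    (hB : MeasurableSet B) (hfin : lam B ≠ ∞) {E : Set (Config X)} (hE : MeasurableSet E) :
    ∫⁻ ω, (η ω).toMeasure B * E.indicator 1 (η ω) ∂P =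
      ∫⁻ x in B, ∫⁻ ω, E.indicator 1 ((η ω).add x) ∂P ∂lam := by
  have hadd : Measurable fun p : X × Ω => (η p.2).add p.1 :=
    Config.measurable_add.comp ((hη.measurable.comp measurable_snd).prodMk measurable_fst)
  have : IsFiniteMeasure (lam.restrict B) := ⟨by simpa using hfin.lt_top⟩
  let M₁ : Measure (Config X) := (P.withDensity fun ω => (η ω).toMeasure B).map η
  let M₂ : Measure (Config X) := ((lam.restrict B).prod P).map fun p => (η p.2).add p.1
  have h₁ {E : Set (Config X)} (hE : MeasurableSet E) :
      M₁ E = ∫⁻ ω, (η ω).toMeasure B * E.indicator 1 (η ω) ∂P := by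
    rw [Measure.map_apply hη.measurable hE, withDensity_apply _ (hη.measurable hE),
      ← lintegral_indicator (hη.measurable hE)]
    congr 1 with ω
    by_cases h : η ω ∈ E <;> simp [h]
  have h₂ {E : Set (Config X)} (hE : MeasurableSet E) :
      M₂ E = ∫⁻ x in B, ∫⁻ ω, E.indicator 1 ((η ω).add x) ∂P ∂lam := by
    rw [← lintegral_indicator_one hE, lintegral_map (measurable_one.indicator hE) hadd,
      lintegral_prod (fun p : X × Ω => E.indicator 1 ((η p.2).add p.1))
        ((measurable_one.indicator hE).comp hadd).aemeasurable]
  have : IsFiniteMeasure M₁ := ⟨by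
    rw [h₁ MeasurableSet.univ]
    simpa [hη.lintegral_count hB hfin] using hfin.lt_top⟩
  have : M₁ = M₂ := by
    refine ext_of_generate_finite _ Config.generateFrom_cylinders Config.isPiSystem_cylinders ?_ ?_
    · intro E hE
      have hE' : MeasurableSet E := by
        rw [Config.generateFrom_cylinders]
        exact MeasurableSpace.measurableSet_generateFrom hE
      rw [h₁ hE', h₂ hE', hη.mecke_cylinder hB hfin hE]
    · rw [h₁ MeasurableSet.univ, h₂ MeasurableSet.univ]
      simp [hη.lintegral_count hB hfin]
  rw [← h₁ hE, ← h₂ hE, this]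

end

/-! ### The Mecke equations for one and for two points -/

section

variable {Ω X : Type*} [MeasurableSpace Ω] [MeasurableSpace X]

lemma Config.add_right_comm (μ : Config X) (x y : X) : (μ.add x).add y = (μ.add y).add x := by
  refine Subtype.ext ?_
  change μ.toMeasure + Measure.dirac x + Measure.dirac y =
    μ.toMeasure + Measure.dirac y + Measure.dirac x
  exact _root_.add_right_comm _ _ _

/-- A countable measurable partition of the space into cells of finite measure. -/
def cell (lam : Measure X) [SigmaFinite lam] (n : ℕ) : Set X := disjointed (spanningSets lam) n

variable (lam : Measure X) [SigmaFinite lam]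

lemma measurableSet_cell (n : ℕ) : MeasurableSet (cell lam n) :=
  .disjointed (fun _ => measurableSet_spanningSets lam _) n

lemma measure_cell_ne_top (n : ℕ) : lam (cell lam n) ≠ ∞ :=
  ne_top_of_le_ne_top (measure_spanningSets_lt_top lam n).ne
    (measure_mono (disjointed_subset _ _))

lemma pairwise_disjoint_cell : Pairwise (Function.onFun Disjoint (cell lam)) :=
  disjoint_disjointed _

lemma iUnion_cell : ⋃ n, cell lam n = Set.univ := by
  simp only [cell, iUnion_disjointed, iUnion_spanningSets]

/-- The configurations with finitely many points in each cell. -/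
def Config.cellFinite : Set (Config X) := {μ | ∀ n, μ.toMeasure (cell lam n) ≠ ∞}

lemma Config.measurableSet_cellFinite : MeasurableSet (Config.cellFinite lam) := by
  rw [Config.cellFinite, Set.ofPred_forall]
  exact MeasurableSet.iInter fun n =>
    (Config.measurable_apply (measurableSet_cell lam n)) (measurableSet_singleton ∞).compl

variable {lam} in
lemma Config.add_mem_cellFinite {μ : Config X} (hμ : μ ∈ Config.cellFinite lam) (x : X) :
    μ.add x ∈ Config.cellFinite lam := by
  intro n
  rw [Config.toMeasure_add_apply _ _ (measurableSet_cell lam n)]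
  refine ENNReal.add_ne_top.2 ⟨hμ n, ?_⟩
  by_cases hx : x ∈ cell lam n <;> simp [hx]

open Classical in
/-- The kernel that sends `μ` to its restriction to the `n`-th cell if that cell contains exactly
`k` points, and to `0` otherwise. -/
noncomputable def cellKernel (n k : ℕ) : Kernel (Config X) X where
  toFun μ := if μ.toMeasure (cell lam n) = k then μ.toMeasure.restrict (cell lam n) else 0
  measurable' := by
    refine Measurable.ite ((Config.measurable_apply (measurableSet_cell lam n))
      (measurableSet_singleton _)) ?_ measurable_const
    refine Measure.measurable_of_measurable_coe _ fun A hA => ?_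
    simp only [Measure.restrict_apply hA]
    exact Config.measurable_apply (hA.inter (measurableSet_cell lam n))

instance (n k : ℕ) : IsFiniteKernel (cellKernel lam n k) :=
  ⟨⟨k, ENNReal.natCast_lt_top k, fun μ => by
    by_cases h : μ.toMeasure (cell lam n) = k <;> simp [cellKernel, h]⟩⟩

/-- The kernel `μ ↦ μ` from configurations to measures, modified outside of
`Config.cellFinite lam` so as to be s-finite. -/
noncomputable def pointKernel : Kernel (Config X) X :=
  Kernel.sum fun p : ℕ × ℕ => cellKernel lam p.1 p.2

instance : IsSFiniteKernel (pointKernel lam) :=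
  Kernel.isSFiniteKernel_sum (κs := fun p : ℕ × ℕ => cellKernel lam p.1 p.2)

variable {lam}

/-- Since counts are integers or `∞`, each finite count selects exactly one of the kernels
`cellKernel lam n k`, so the sum over `k` restores the restriction of `μ` to the `n`-th cell. -/
lemma pointKernel_apply {μ : Config X} (hμ : μ ∈ Config.cellFinite lam) :
    pointKernel lam μ = μ.toMeasure := by
  have h (n : ℕ) : ∃ k : ℕ, μ.toMeasure (cell lam n) = k := by
    obtain ⟨m, hm⟩ := μ.2.2 _ (measurableSet_cell lam n)
    have hm' : μ.toMeasure (cell lam n) = m := hm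
    have := hμ n
    rw [hm'] at this
    lift m to ℕ using by simpa using this
    exact ⟨m, by simpa using hm'⟩
  choose k hk using h
  ext A hA
  rw [pointKernel, Kernel.sum_apply' _ _ hA, 
    ENNReal.tsum_prod (f := fun n j => cellKernel lam n j μ A)]
  have h1 (n : ℕ) : ∑' j, cellKernel lam n j μ A = μ.toMeasure.restrict (cell lam n) A := by
    rw [tsum_eq_single (k n)]
    · simp [cellKernel, hk]
    · intro j hj
      simp [cellKernel, hk, hj.symm]
  simp only [h1]
  rw [← Measure.sum_apply _ hA, ← Measure.restrict_iUnion (pairwise_disjoint_cell lam)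
    (measurableSet_cell lam), iUnion_cell, Measure.restrict_univ]

variable (lam) in
/-- A law `Q` on configurations satisfies the Mecke equation with intensity `lam`. -/
structure SatisfiesMecke (Q : Measure (Config X)) : Prop where
  ae_cellFinite : ∀ᵐ μ ∂Q, μ ∈ Config.cellFinite lam
  compProd_eq : Q ⊗ₘ pointKernel lam = (Q.prod lam).map fun p => (p.1.add p.2, p.2)

omit [SigmaFinite lam] in
lemma isPiSystem_finiteMeasure :
    IsPiSystem {B : Set X | MeasurableSet B ∧ lam B ≠ ∞} := fun _ hA _ hB _ =>
  ⟨hA.1.inter hB.1, ne_top_of_le_ne_top hA.2 (measure_mono Set.inter_subset_left)⟩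

lemma generateFrom_finiteMeasure :
    MeasurableSpace.generateFrom {B : Set X | MeasurableSet B ∧ lam B ≠ ∞} = ‹_› := by
  refine le_antisymm (MeasurableSpace.generateFrom_le fun B hB => hB.1) fun A hA => ?_
  have : A = ⋃ n, A ∩ cell lam n := by rw [← Set.inter_iUnion, iUnion_cell, Set.inter_univ]
  rw [this]
  refine MeasurableSet.iUnion fun n => MeasurableSpace.measurableSet_generateFrom
    ⟨hA.inter (measurableSet_cell lam n), ne_top_of_le_ne_top (measure_cell_ne_top lam n)
      (measure_mono Set.inter_subset_right)⟩

lemma measurable_add_prod : Measurable fun p : Config X × X => (p.1.add p.2, p.2) :=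
  Config.measurable_add.prodMk measurable_snd

/-- The Mecke equation for a Poisson process. -/
theorem IsPoissonProcess.satisfiesMecke {P : Measure Ω} [IsProbabilityMeasure P]
    {η : Ω → Config X} (hη : IsPoissonProcess P η lam) : SatisfiesMecke lam (P.map η) := by
  have hfin : ∀ᵐ μ ∂(P.map η), μ ∈ Config.cellFinite lam := by
    refine (ae_map_iff (p := fun μ => μ ∈ Config.cellFinite lam) hη.measurable.aemeasurable
      (Config.measurableSet_cellFinite lam)).2 ?_
    have (n : ℕ) : ∀ᵐ ω ∂P, (η ω).toMeasure (cell lam n) ≠ ∞ := by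
      refine (ae_lt_top ((Config.measurable_apply (measurableSet_cell lam n)).comp
        hη.measurable) ?_).mono fun ω hω => hω.ne
      exact (hη.lintegral_count (measurableSet_cell lam n) (measure_cell_ne_top lam n)).trans_ne
        (measure_cell_ne_top lam n)
    filter_upwards [ae_all_iff.2 this] with ω hω using hω
  have : IsProbabilityMeasure (P.map η) :=
    Measure.isProbabilityMeasure_map hη.measurable.aemeasurable
  refine ⟨hfin, ?_⟩
  have hrect (E : Set (Config X)) (hE : MeasurableSet E) (B : Set X) (hB : MeasurableSet B) :
      (P.map η ⊗ₘ pointKernel lam) (E ×ˢ B) =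
        ∫⁻ ω, (η ω).toMeasure B * E.indicator 1 (η ω) ∂P := by
    rw [Measure.compProd_apply_prod hE hB, ← lintegral_indicator hE,
      lintegral_congr_ae (g := fun μ => μ.toMeasure B * E.indicator 1 μ),
      lintegral_map (f := fun μ : Config X => μ.toMeasure B * E.indicator 1 μ)
        ((Config.measurable_apply hB).mul (measurable_one.indicator hE)) hη.measurable]
    filter_upwards [hfin] with μ hμ
    by_cases h : μ ∈ E <;> simp [h, pointKernel_apply hμ]
  refine Measure.ext_of_generateFrom_of_iUnion
    (Set.image2 (· ×ˢ ·) {E : Set (Config X) | MeasurableSet E}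
      {B : Set X | MeasurableSet B ∧ lam B ≠ ∞})
    (fun n => Set.univ ×ˢ cell lam n) ?_ ?_ ?_ ?_ ?_ ?_
  · refine (generateFrom_eq_prod MeasurableSpace.generateFrom_measurableSet
      generateFrom_finiteMeasure isCountablySpanning_measurableSet ?_).symm
    exact ⟨cell lam, fun n => ⟨measurableSet_cell lam n, measure_cell_ne_top lam n⟩,
      iUnion_cell lam⟩
  · exact MeasurableSpace.isPiSystem_measurableSet.prod isPiSystem_finiteMeasure
  · rw [← Set.prod_iUnion, iUnion_cell, Set.univ_prod_univ]
  · exact fun n => ⟨Set.univ, MeasurableSet.univ (α := Config X), _,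
      ⟨measurableSet_cell lam n, measure_cell_ne_top lam n⟩, rfl⟩
  · intro n
    rw [hrect _ .univ _ (measurableSet_cell lam n)]
    simpa [hη.lintegral_count (measurableSet_cell lam n) (measure_cell_ne_top lam n)] using
      measure_cell_ne_top lam n
  · rintro _ ⟨E, hE, B, ⟨hB, hBf⟩, rfl⟩
    have hE : MeasurableSet E := hE
    rw [hrect E hE B hB, hη.mecke_rectangle hB hBf hE,
      Measure.map_apply measurable_add_prod (hE.prod hB),
      Measure.prod_apply_symm (measurable_add_prod (hE.prod hB)), ← lintegral_indicator hB]
    congr 1 with x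
    by_cases hx : x ∈ B
    · have hm : Measurable fun μ : Config X => μ.add x :=
        Config.measurable_add.comp (measurable_id.prodMk measurable_const)
      have : (fun μ : Config X => (μ, x)) ⁻¹' ((fun p : Config X × X => (p.1.add p.2, p.2)) ⁻¹'
          (E ×ˢ B)) = (fun μ : Config X => μ.add x) ⁻¹' E := by
        ext μ
        simp [hx]
      rw [this, Set.indicator_of_mem hx, ← lintegral_indicator_one (hm hE),
        lintegral_map (measurable_one.indicator (hm hE)) hη.measurable]
      rfl
    · have : (fun μ : Config X => (μ, x)) ⁻¹' ((fun p : Config X × X => (p.1.add p.2, p.2)) ⁻¹'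
          (E ×ˢ B)) = ∅ := by
        ext μ
        simp [hx]
      rw [this, Set.indicator_of_notMem hx, measure_empty]

variable {Q : Measure (Config X)} [IsProbabilityMeasure Q]

lemma SatisfiesMecke.lintegral_eq (hQ : SatisfiesMecke lam Q) {g : Config X × X → ℝ≥0∞}
    (hg : Measurable g) :
    ∫⁻ μ, ∫⁻ x, g (μ, x) ∂(pointKernel lam μ) ∂Q = ∫⁻ μ, ∫⁻ x, g (μ.add x, x) ∂lam ∂Q := by
  rw [← Measure.lintegral_compProd hg, hQ.compProd_eq, lintegral_map hg measurable_add_prod,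
    lintegral_prod (fun p : Config X × X => g (p.1.add p.2, p.2))
      (hg.comp measurable_add_prod).aemeasurable]

lemma measurable_add_diag : Measurable fun p : Config X × X => (p.1.add p.2, (p.2, p.2)) :=
  Config.measurable_add.prodMk (measurable_snd.prodMk measurable_snd)

lemma measurable_add_add :
    Measurable fun p : Config X × (X × X) => ((p.1.add p.2.1).add p.2.2, p.2) :=
  (Config.measurable_add.comp ((Config.measurable_add.comp
    (measurable_fst.prodMk (measurable_fst.comp measurable_snd))).prodMk
      (measurable_snd.comp measurable_snd))).prodMk measurable_snd

set_option maxHeartbeats 800000 in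
/-- The Mecke equation for pairs of points: the pairs that consist of one point taken twice give
the first term on the right, the pairs of distinct points the second. It comes from applying the
Mecke equation to each point of the pair in turn. -/
theorem SatisfiesMecke.compProd_prod_eq (hQ : SatisfiesMecke lam Q) :
    Q ⊗ₘ (pointKernel lam ×ₖ pointKernel lam) =
      (Q.prod lam).map (fun p => (p.1.add p.2, (p.2, p.2))) +
      (Q.prod (lam.prod lam)).map (fun p => ((p.1.add p.2.1).add p.2.2, p.2)) := by
  refine Measure.ext_of_lintegral _ fun g hg => ?_
  have hd := hg.comp measurable_add_diag
  have ho := hg.comp measurable_add_add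
  have hG : Measurable fun p : Config X × X =>
      ∫⁻ y, g (p.1, (p.2, y)) ∂(pointKernel lam p.1) :=
    Measurable.lintegral_kernel_prod_right'
      (κ := (pointKernel lam).comap (Prod.fst : Config X × X → Config X) measurable_fst)
      (f := fun q : (Config X × X) × X => g (q.1.1, (q.1.2, q.2))) (by fun_prop)
  -- The second point of a pair either is the added point `x` or belongs to `μ`.
  have hadd {μ : Config X} (hμ : μ ∈ Config.cellFinite lam) (x : X) :
      ∫⁻ y, g (μ.add x, (x, y)) ∂(pointKernel lam (μ.add x)) =
        g (μ.add x, (x, x)) + ∫⁻ y, g (μ.add x, (x, y)) ∂(pointKernel lam μ) := by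
    rw [pointKernel_apply hμ, pointKernel_apply (Config.add_mem_cellFinite hμ x),
      Config.toMeasure_add, lintegral_add_measure, lintegral_dirac' _ (by fun_prop), add_comm]
  have hswap (x : X) : ∫⁻ μ, ∫⁻ y, g (μ.add x, (x, y)) ∂(pointKernel lam μ) ∂Q =
      ∫⁻ μ, ∫⁻ y, g ((μ.add x).add y, (x, y)) ∂lam ∂Q := by
    have hx : Measurable fun p : Config X × X => g (p.1.add x, (x, p.2)) :=
      hg.comp ((Config.measurable_add.comp (measurable_fst.prodMk measurable_const)).prodMk
        (measurable_const.prodMk measurable_snd))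
    simp only [hQ.lintegral_eq hx, Config.add_right_comm _ x]
  have hm : Measurable fun p : Config X × X =>
      ∫⁻ y, g (p.1.add p.2, (p.2, y)) ∂(pointKernel lam p.1) :=
    Measurable.lintegral_kernel_prod_right'
      (κ := (pointKernel lam).comap (Prod.fst : Config X × X → Config X) measurable_fst)
      (f := fun q : (Config X × X) × X => g (q.1.1.add q.1.2, (q.1.2, q.2)))
      (hg.comp ((Config.measurable_add.comp measurable_fst).prodMk
        ((measurable_snd.comp measurable_fst).prodMk measurable_snd)))
  have ho' (μ : Config X) : Measurable fun p : X × X => g ((μ.add p.1).add p.2, p) :=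
    ho.comp (measurable_prodMk_left (x := μ))
  calc ∫⁻ p, g p ∂(Q ⊗ₘ (pointKernel lam ×ₖ pointKernel lam))
      = ∫⁻ μ, ∫⁻ x, ∫⁻ y, g (μ, (x, y)) ∂(pointKernel lam μ) ∂(pointKernel lam μ) ∂Q := by
        rw [Measure.lintegral_compProd hg]
        congr 1 with μ
        rw [Kernel.prod_apply, lintegral_prod _ (by fun_prop)]
    _ = ∫⁻ μ, ∫⁻ x, ∫⁻ y, g (μ.add x, (x, y)) ∂(pointKernel lam (μ.add x)) ∂lam ∂Q :=
        hQ.lintegral_eq hG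
    _ = ∫⁻ μ, (∫⁻ x, g (μ.add x, (x, x)) ∂lam +
          ∫⁻ x, ∫⁻ y, g (μ.add x, (x, y)) ∂(pointKernel lam μ) ∂lam) ∂Q := by
        refine lintegral_congr_ae (hQ.ae_cellFinite.mono fun μ hμ => ?_)
        simp only [hadd hμ]
        exact lintegral_add_left (hd.comp (measurable_prodMk_left (x := μ))) _
    _ = ∫⁻ μ, ∫⁻ x, g (μ.add x, (x, x)) ∂lam ∂Q +
          ∫⁻ μ, ∫⁻ x, ∫⁻ y, g (μ.add x, (x, y)) ∂(pointKernel lam μ) ∂lam ∂Q :=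
        lintegral_add_left hd.lintegral_prod_right' _
    _ = ∫⁻ μ, ∫⁻ x, g (μ.add x, (x, x)) ∂lam ∂Q +
          ∫⁻ μ, ∫⁻ p : X × X, g ((μ.add p.1).add p.2, p) ∂(lam.prod lam) ∂Q := by
        congr 1
        rw [lintegral_lintegral_swap hm.aemeasurable]
        simp only [hswap]
        rw [lintegral_lintegral_swap]
        · congr 1 with μ
          rw [lintegral_prod _ (ho' μ).aemeasurable]
        · exact (Measurable.lintegral_prod_right'
            (f := fun q : (X × Config X) × X => g ((q.1.2.add q.1.1).add q.2, (q.1.1, q.2)))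
            (ho.comp ((measurable_snd.comp measurable_fst).prodMk
              ((measurable_fst.comp measurable_fst).prodMk measurable_snd)))).aemeasurable
    _ = _ := by
        rw [lintegral_add_measure, lintegral_map hg measurable_add_diag,
          lintegral_map hg measurable_add_add,
          lintegral_prod (fun p : Config X × X => g (p.1.add p.2, (p.2, p.2))) hd.aemeasurable,
          lintegral_prod (fun p : Config X × (X × X) => g ((p.1.add p.2.1).add p.2.2, p.2))
            ho.aemeasurable]

end

/-! ### Moments of a sum of scores under the Mecke equations -/

section

variable {X : Type*} [MeasurableSpace X] {lam : Measure X} [SigmaFinite lam]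
  {Q : Measure (Config X)} [IsProbabilityMeasure Q] {f : X → Config X → ℝ}

omit [IsProbabilityMeasure Q] in
/-- A property that holds for almost every configuration also holds, for almost every `x`, after
the addition of the point `x`. -/
lemma SatisfiesMecke.ae_add (hQ : SatisfiesMecke lam Q) {p : Config X → Prop}
    (hp : MeasurableSet {μ | p μ}) (h : ∀ᵐ μ ∂Q, p μ) :
    ∀ᵐ q ∂(Q.prod lam), p (q.1.add q.2) := by
  have h1 := Measure.ae_compProd_of_ae_fst (pointKernel lam) hp h
  rw [hQ.compProd_eq] at h1
  exact ae_of_ae_map measurable_add_prod.aemeasurable h1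

/-- The function `(μ, (x, y)) ↦ f(x, μ) f(y, μ)`. -/
def pairProduct (f : X → Config X → ℝ) (q : Config X × (X × X)) : ℝ :=
  f q.2.1 q.1 * f q.2.2 q.1

lemma measurable_pairProduct (hf : Measurable (Function.uncurry f)) :
    Measurable (pairProduct f) :=
  (hf.comp (measurable_snd.fst.prodMk measurable_fst)).mul
    (hf.comp (measurable_snd.snd.prodMk measurable_fst))

lemma measurable_score_add (hf : Measurable (Function.uncurry f)) :
    Measurable fun p : Config X × X => f p.2 (p.1.add p.2) :=
  hf.comp (measurable_snd.prodMk Config.measurable_add)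

lemma measurable_lintegral_enorm (hf : Measurable (Function.uncurry f)) :
    Measurable fun μ => ∫⁻ x, ‖f x μ‖ₑ ∂(pointKernel lam μ) :=
  Measurable.lintegral_kernel_prod_right' (f := fun p : Config X × X => ‖f p.2 p.1‖ₑ)
    (hf.comp measurable_swap).enorm

lemma stronglyMeasurable_integral_score (hf : Measurable (Function.uncurry f)) :
    StronglyMeasurable fun μ => ∫ x, f x μ ∂(pointKernel lam μ) :=
  StronglyMeasurable.integral_kernel_prod_right'
    (f := fun p : Config X × X => f p.2 p.1) (hf.comp measurable_swap).stronglyMeasurable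

lemma lintegral_enorm_pairProduct (hf : Measurable (Function.uncurry f)) :
    ∫⁻ q, ‖pairProduct f q‖ₑ ∂(Q ⊗ₘ (pointKernel lam ×ₖ pointKernel lam)) =
      ∫⁻ μ, (∫⁻ x, ‖f x μ‖ₑ ∂(pointKernel lam μ)) ^ 2 ∂Q := by
  rw [Measure.lintegral_compProd (measurable_pairProduct hf).enorm]
  congr 1 with μ
  have hm : Measurable fun x => ‖f x μ‖ₑ := (hf.comp measurable_prodMk_right).enorm
  simp only [pairProduct, enorm_mul]
  rw [Kernel.prod_apply, lintegral_prod_mul hm.aemeasurable hm.aemeasurable, sq]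

lemma SatisfiesMecke.integrable_pairProduct_iff (hQ : SatisfiesMecke lam Q)
    (hf : Measurable (Function.uncurry f)) :
    Integrable (pairProduct f) (Q ⊗ₘ (pointKernel lam ×ₖ pointKernel lam)) ↔
      Integrable (fun p : Config X × X => f p.2 (p.1.add p.2) ^ 2) (Q.prod lam) ∧
      Integrable (fun q : Config X × (X × X) => scoreProduct f q.1 q.2.1 q.2.2)
        (Q.prod (lam.prod lam)) := by
  have hm := measurable_pairProduct hf
  rw [hQ.compProd_prod_eq, integrable_add_measure,
    integrable_map_measure hm.aestronglyMeasurable measurable_add_diag.aemeasurable,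
    integrable_map_measure hm.aestronglyMeasurable measurable_add_add.aemeasurable]
  simp only [Function.comp_def, pairProduct, sq]
  rfl

/-- The second moment of a sum of scores. -/
lemma SatisfiesMecke.integral_sq (hQ : SatisfiesMecke lam Q)
    (hf : Measurable (Function.uncurry f))
    (hi : Integrable (pairProduct f) (Q ⊗ₘ (pointKernel lam ×ₖ pointKernel lam))) :
    ∫ μ, (∫ x, f x μ ∂(pointKernel lam μ)) ^ 2 ∂Q =
      ∫ p, f p.2 (p.1.add p.2) ^ 2 ∂(Q.prod lam) +
        ∫ q, scoreProduct f q.1 q.2.1 q.2.2 ∂(Q.prod (lam.prod lam)) := by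
  have hm := measurable_pairProduct hf
  have h1 : ∫ q, pairProduct f q ∂(Q ⊗ₘ (pointKernel lam ×ₖ pointKernel lam)) =
      ∫ μ, (∫ x, f x μ ∂(pointKernel lam μ)) ^ 2 ∂Q := by
    rw [Measure.integral_compProd hi]
    congr 1 with μ
    simp only [pairProduct]
    rw [Kernel.prod_apply, integral_prod_mul (fun x => f x μ) (fun y => f y μ), sq]
  rw [← h1]
  rw [hQ.compProd_prod_eq, integrable_add_measure] at hi
  rw [hQ.compProd_prod_eq, integral_add_measure hi.1 hi.2,
    integral_map measurable_add_diag.aemeasurable hm.aestronglyMeasurable,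
    integral_map measurable_add_add.aemeasurable hm.aestronglyMeasurable]
  simp only [pairProduct, sq]
  rfl

lemma integrable_score (hf : Measurable (Function.uncurry f))
    (hi : Integrable (pairProduct f) (Q ⊗ₘ (pointKernel lam ×ₖ pointKernel lam))) :
    Integrable (fun p : Config X × X => f p.2 p.1) (Q ⊗ₘ pointKernel lam) := by
  have hfs : Measurable fun p : Config X × X => f p.2 p.1 := hf.comp measurable_swap
  refine ⟨hfs.aestronglyMeasurable, ?_⟩
  have hlt := hi.2
  rw [HasFiniteIntegral, lintegral_enorm_pairProduct hf] at hlt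
  rw [HasFiniteIntegral, Measure.lintegral_compProd hfs.enorm]
  calc ∫⁻ μ, ∫⁻ x, ‖f x μ‖ₑ ∂(pointKernel lam μ) ∂Q
      ≤ ∫⁻ μ, (1 + (∫⁻ x, ‖f x μ‖ₑ ∂(pointKernel lam μ)) ^ 2) ∂Q := by
        refine lintegral_mono fun μ => ?_
        rcases le_total (∫⁻ x, ‖f x μ‖ₑ ∂(pointKernel lam μ)) 1 with h | h
        · exact h.trans le_self_add
        · exact (le_self_pow₀ h two_ne_zero).trans le_add_self
    _ < ∞ := by
        rw [lintegral_add_left measurable_const]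
        simpa using hlt

lemma SatisfiesMecke.integrable_score_add (hQ : SatisfiesMecke lam Q)
    (hf : Measurable (Function.uncurry f))
    (hi : Integrable (pairProduct f) (Q ⊗ₘ (pointKernel lam ×ₖ pointKernel lam))) :
    Integrable (fun p : Config X × X => f p.2 (p.1.add p.2)) (Q.prod lam) := by
  have h := integrable_score hf hi
  rw [hQ.compProd_eq] at h
  exact h.comp_measurable measurable_add_prod

/-- The mean of a sum of scores. -/
lemma SatisfiesMecke.integral_eq (hQ : SatisfiesMecke lam Q)
    (hf : Measurable (Function.uncurry f))
    (hi : Integrable (pairProduct f) (Q ⊗ₘ (pointKernel lam ×ₖ pointKernel lam))) :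
    ∫ μ, ∫ x, f x μ ∂(pointKernel lam μ) ∂Q = ∫ p, f p.2 (p.1.add p.2) ∂(Q.prod lam) := by
  have hfs : Measurable fun p : Config X × X => f p.2 p.1 := hf.comp measurable_swap
  have h1 := integrable_score hf hi
  rw [← Measure.integral_compProd h1, hQ.compProd_eq,
    integral_map measurable_add_prod.aemeasurable hfs.aestronglyMeasurable]

open Classical in
/-- The scores, set to `0` on the configurations with `∑ |f(x, μ)| > k`. -/
noncomputable def truncScore (lam : Measure X) [SigmaFinite lam] (f : X → Config X → ℝ) (k : ℕ)
    (x : X) (μ : Config X) : ℝ :=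
  if ∫⁻ x, ‖f x μ‖ₑ ∂(pointKernel lam μ) ≤ k then f x μ else 0

lemma measurable_truncScore (hf : Measurable (Function.uncurry f)) (k : ℕ) :
    Measurable (Function.uncurry (truncScore lam f k)) :=
  Measurable.ite (((measurable_lintegral_enorm (lam := lam) hf).comp measurable_snd)
    measurableSet_Iic) hf measurable_const

lemma integrable_pairProduct_truncScore (hf : Measurable (Function.uncurry f)) (k : ℕ) :
    Integrable (pairProduct (truncScore lam f k))
      (Q ⊗ₘ (pointKernel lam ×ₖ pointKernel lam)) := by
  have hm := measurable_truncScore (lam := lam) hf k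
  refine ⟨(measurable_pairProduct hm).aestronglyMeasurable, ?_⟩
  rw [HasFiniteIntegral, lintegral_enorm_pairProduct hm]
  calc _ ≤ ∫⁻ _ : Config X, (k : ℝ≥0∞) ^ 2 ∂Q := by
        refine lintegral_mono fun μ => pow_le_pow_left' ?_ 2
        by_cases h : ∫⁻ x, ‖f x μ‖ₑ ∂(pointKernel lam μ) ≤ k <;> simp [truncScore, h]
    _ < ∞ := by simp

/-- If a sum of scores converges absolutely and is square-integrable, and the products of scores
of pairs of distinct points are integrable, then the squared scores are integrable as well. For
truncated scores the squared scores are the square of the sum minus the sum over the pairs of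
distinct points, which is bounded uniformly in the truncation level. -/
theorem SatisfiesMecke.integrable_sq (hQ : SatisfiesMecke lam Q)
    (hf : Measurable (Function.uncurry f))
    (hconv : ∀ᵐ μ ∂Q, Integrable (fun x => f x μ) (pointKernel lam μ))
    (hL2 : MemLp (fun μ => ∫ x, f x μ ∂(pointKernel lam μ)) 2 Q)
    (hprod : Integrable (fun q : Config X × (X × X) => scoreProduct f q.1 q.2.1 q.2.2)
      (Q.prod (lam.prod lam))) :
    Integrable (fun p : Config X × X => f p.2 (p.1.add p.2) ^ 2) (Q.prod lam) := by
  set M : ℝ := ∫ μ, (∫ x, f x μ ∂(pointKernel lam μ)) ^ 2 ∂Q +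
    ∫ q, |scoreProduct f q.1 q.2.1 q.2.2| ∂(Q.prod (lam.prod lam)) with hM
  have hbound (k : ℕ) : ∫⁻ p, ENNReal.ofReal (truncScore lam f k p.2 (p.1.add p.2) ^ 2)
      ∂(Q.prod lam) ≤ ENNReal.ofReal M := by
    have hm := measurable_truncScore (lam := lam) hf k
    have hi := integrable_pairProduct_truncScore (Q := Q) (lam := lam) hf k
    have h1 := hQ.integral_sq hm hi
    obtain ⟨h2, h3⟩ := (hQ.integrable_pairProduct_iff hm).1 hi
    rw [← ofReal_integral_eq_lintegral_ofReal h2 (ae_of_all _ fun p => sq_nonneg _)]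
    refine ENNReal.ofReal_le_ofReal ?_
    have h4 : ∫ μ, (∫ x, truncScore lam f k x μ ∂(pointKernel lam μ)) ^ 2 ∂Q ≤
        ∫ μ, (∫ x, f x μ ∂(pointKernel lam μ)) ^ 2 ∂Q := by
      refine integral_mono_of_nonneg (ae_of_all _ fun μ => sq_nonneg _) hL2.integrable_sq
        (ae_of_all _ fun μ => ?_)
      by_cases h : ∫⁻ x, ‖f x μ‖ₑ ∂(pointKernel lam μ) ≤ k
      · simp [truncScore, h]
      · simp only [truncScore, h, if_false, integral_zero]
        simpa using sq_nonneg _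
    -- Truncation can only decrease the products in absolute value.
    have h5 : -∫ q, |scoreProduct f q.1 q.2.1 q.2.2| ∂(Q.prod (lam.prod lam)) ≤
        ∫ q, scoreProduct (truncScore lam f k) q.1 q.2.1 q.2.2 ∂(Q.prod (lam.prod lam)) := by
      rw [← integral_neg]
      refine integral_mono hprod.abs.neg h3 fun q => ?_
      by_cases h : ∫⁻ x, ‖f x ((q.1.add q.2.1).add q.2.2)‖ₑ
          ∂(pointKernel lam ((q.1.add q.2.1).add q.2.2)) ≤ k
      · simpa only [scoreProduct, truncScore, h, if_true] using neg_abs_le _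
      · simp only [scoreProduct, truncScore, h, if_false, mul_zero, Left.neg_nonpos_iff]
        exact abs_nonneg _
    rw [hM]
    linarith
  have hm := measurable_score_add hf
  have hfin : ∀ᵐ q ∂(Q.prod lam),
      ∫⁻ x, ‖f x (q.1.add q.2)‖ₑ ∂(pointKernel lam (q.1.add q.2)) < ∞ :=
    hQ.ae_add ((measurable_lintegral_enorm hf) measurableSet_Iio)
      (hconv.mono fun μ hμ => hμ.2)
  refine ⟨(hm.pow_const 2).aestronglyMeasurable, ?_⟩
  rw [hasFiniteIntegral_iff_ofReal (ae_of_all _ fun p => sq_nonneg _)]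
  refine lt_of_le_of_lt ?_ (ENNReal.ofReal_lt_top (r := M))
  calc ∫⁻ p, ENNReal.ofReal (f p.2 (p.1.add p.2) ^ 2) ∂(Q.prod lam)
      = ∫⁻ p, liminf (fun k => ENNReal.ofReal (truncScore lam f k p.2 (p.1.add p.2) ^ 2)) atTop
          ∂(Q.prod lam) := by
        refine lintegral_congr_ae (hfin.mono fun p hp => ?_)
        obtain ⟨N, hN⟩ := ENNReal.exists_nat_gt hp.ne
        refine (Tendsto.liminf_eq (tendsto_const_nhds.congr' ?_)).symm
        filter_upwards [eventually_ge_atTop N] with k hk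
        rw [truncScore, if_pos]
        exact hN.le.trans (by exact_mod_cast hk)
    _ ≤ liminf (fun k => ∫⁻ p, ENNReal.ofReal (truncScore lam f k p.2 (p.1.add p.2) ^ 2)
          ∂(Q.prod lam)) atTop := lintegral_liminf_le fun k =>
        ((measurable_score_add (measurable_truncScore hf k)).pow_const 2).ennreal_ofReal
    _ ≤ ENNReal.ofReal M :=
        liminf_le_of_le ⟨0, by simp⟩ fun b hb => by
          obtain ⟨k, hk⟩ := hb.exists
          exact hk.trans (hbound k)

/-- The variance of a sum of scores. -/
theorem SatisfiesMecke.variance_eq (hQ : SatisfiesMecke lam Q)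
    (hf : Measurable (Function.uncurry f))
    (hconv : ∀ᵐ μ ∂Q, Integrable (fun x => f x μ) (pointKernel lam μ))
    (hL2 : MemLp (fun μ => ∫ x, f x μ ∂(pointKernel lam μ)) 2 Q)
    (hprod : Integrable (fun q : Config X × (X × X) => scoreProduct f q.1 q.2.1 q.2.2)
      (Q.prod (lam.prod lam))) :
    variance (fun μ => ∫ x, f x μ ∂(pointKernel lam μ)) Q =
      ∫ p, f p.2 (p.1.add p.2) ^ 2 ∂(Q.prod lam) +
        (∫ q, scoreProduct f q.1 q.2.1 q.2.2 ∂(Q.prod (lam.prod lam)) -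
          (∫ p, f p.2 (p.1.add p.2) ∂(Q.prod lam)) ^ 2) := by
  have hi := (hQ.integrable_pairProduct_iff hf).2
    ⟨hQ.integrable_sq hf hconv hL2 hprod, hprod⟩
  rw [variance_eq_sub hL2, ← hQ.integral_eq hf hi, ← add_sub_assoc, ← hQ.integral_sq hf hi]
  rfl

end

/-! ### Sums of scores of a Poisson process -/

section

variable {Ω X : Type*} [MeasurableSpace Ω] [MeasurableSpace X] {lam : Measure X}
  [SigmaFinite lam] {P : Measure Ω} [IsProbabilityMeasure P] {η : Ω → Config X}
  {f : X → Config X → ℝ}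

lemma scoreSum_eq {μ : Config X} (hμ : μ ∈ Config.cellFinite lam) :
    scoreSum f μ = ∫ x, f x μ ∂(pointKernel lam μ) := by
  rw [pointKernel_apply hμ]; rfl

lemma IsPoissonProcess.ae_cellFinite (hη : IsPoissonProcess P η lam) :
    ∀ᵐ ω ∂P, η ω ∈ Config.cellFinite lam :=
  ae_of_ae_map hη.measurable.aemeasurable hη.satisfiesMecke.ae_cellFinite

lemma IsPoissonProcess.ae_integrable_pointKernel (hη : IsPoissonProcess P η lam)
    (hf : Measurable (Function.uncurry f))
    (hconv : ∀ᵐ ω ∂P, Integrable (fun x => f x (η ω)) (η ω).toMeasure) :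
    ∀ᵐ μ ∂(P.map η), Integrable (fun x => f x μ) (pointKernel lam μ) := by
  refine (ae_map_iff (p := fun μ => Integrable (fun x => f x μ) (pointKernel lam μ))
    hη.measurable.aemeasurable (measurableSet_kernel_integrable (f := fun μ x => f x μ)
      (hf.comp measurable_swap).stronglyMeasurable)).2 ?_
  filter_upwards [hη.ae_cellFinite, hconv] with ω h1 h2
  rwa [pointKernel_apply h1]

lemma scoreSecondMoment_eq (hη : Measurable η) (hf : Measurable (Function.uncurry f)) :
    scoreSecondMoment P η lam f =
      ∫⁻ p, ENNReal.ofReal (f p.2 (p.1.add p.2) ^ 2) ∂((P.map η).prod lam) := by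
  have : IsProbabilityMeasure (P.map η) := Measure.isProbabilityMeasure_map hη.aemeasurable
  have hm : Measurable fun p : Config X × X => ENNReal.ofReal (f p.2 (p.1.add p.2) ^ 2) :=
    ((measurable_score_add hf).pow_const 2).ennreal_ofReal
  rw [lintegral_prod_symm _ hm.aemeasurable, scoreSecondMoment]
  congr 1 with x
  rw [lintegral_map (f := fun μ : Config X => ENNReal.ofReal (f x (μ.add x) ^ 2))
    (hm.comp measurable_prodMk_right) hη]

lemma measurable_scoreProduct (hf : Measurable (Function.uncurry f)) :
    Measurable fun q : Config X × (X × X) => scoreProduct f q.1 q.2.1 q.2.2 :=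
  (measurable_pairProduct hf).comp measurable_add_add

lemma integrable_scoreProduct_map (hη : Measurable η) (hf : Measurable (Function.uncurry f))
    (h : Integrable (fun q : Ω × (X × X) => scoreProduct f (η q.1) q.2.1 q.2.2)
      (P.prod (lam.prod lam))) :
    Integrable (fun q : Config X × (X × X) => scoreProduct f q.1 q.2.1 q.2.2)
      ((P.map η).prod (lam.prod lam)) := by
  have e : (P.map η).prod (lam.prod lam) =
      (P.prod (lam.prod lam)).map (Prod.map η id) := by
    rw [← Measure.map_prod_map _ _ hη measurable_id, Measure.map_id]
  rw [e, integrable_map_measure (measurable_scoreProduct hf).aestronglyMeasurable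
    (hη.prodMap measurable_id).aemeasurable]
  exact h

lemma pairTerm_eq (hη : Measurable η) (hf : Measurable (Function.uncurry f))
    (h1 : Integrable (fun q : Config X × (X × X) => scoreProduct f q.1 q.2.1 q.2.2)
      ((P.map η).prod (lam.prod lam)))
    (h2 : Integrable (fun p : Config X × X => f p.2 (p.1.add p.2)) ((P.map η).prod lam)) :
    pairTerm P η lam f =
      ∫ q, scoreProduct f q.1 q.2.1 q.2.2 ∂((P.map η).prod (lam.prod lam)) -
        (∫ p, f p.2 (p.1.add p.2) ∂((P.map η).prod lam)) ^ 2 := by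
  have : IsProbabilityMeasure (P.map η) := Measure.isProbabilityMeasure_map hη.aemeasurable
  have e1 (p : X × X) : ∫ ω, scoreProduct f (η ω) p.1 p.2 ∂P =
      ∫ μ, scoreProduct f μ p.1 p.2 ∂(P.map η) := by
    rw [integral_map hη.aemeasurable]
    exact ((measurable_scoreProduct hf).comp measurable_prodMk_right).aestronglyMeasurable
  have e2 (x : X) : ∫ ω, f x ((η ω).add x) ∂P = ∫ μ, f x (μ.add x) ∂(P.map η) := by
    rw [integral_map (f := fun μ : Config X => f x (μ.add x)) hη.aemeasurable]
    exact ((measurable_score_add hf).comp measurable_prodMk_right).aestronglyMeasurable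
  rw [pairTerm, integral_prod_mul (fun x => ∫ ω, f x ((η ω).add x) ∂P)
    (fun y => ∫ ω, f y ((η ω).add y) ∂P), integral_prod_symm _ h1, integral_prod_symm _ h2, sq]
  simp only [e1, e2]

/-- The bounds of the variance and of the second moment of the scores at a single parameter. -/
theorem IsPoissonProcess.evariance_scoreSum_le (hη : IsPoissonProcess P η lam)
    (hf : Measurable (Function.uncurry f))
    (hconv : ∀ᵐ ω ∂P, Integrable (fun x => f x (η ω)) (η ω).toMeasure)
    (hL2 : MemLp (fun ω => scoreSum f (η ω)) 2 P)
    (hprod : Integrable (fun q : Ω × (X × X) => scoreProduct f (η q.1) q.2.1 q.2.2)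
      (P.prod (lam.prod lam)))
    {C : ℝ} (hC : 0 ≤ C)
    (hle : ENNReal.ofReal (pairTerm P η lam f) ≤
      ENNReal.ofReal C * scoreSecondMoment P η lam f) :
    scoreSecondMoment P η lam f ≠ ∞ ∧
      evariance (fun ω => scoreSum f (η ω)) P ≤
        ENNReal.ofReal (1 + C) * scoreSecondMoment P η lam f := by
  have hm := hη.measurable
  have : IsProbabilityMeasure (P.map η) := Measure.isProbabilityMeasure_map hm.aemeasurable
  have hQ := hη.satisfiesMecke
  have hconv' := hη.ae_integrable_pointKernel hf hconv
  have hF : (fun ω => scoreSum f (η ω)) =ᵐ[P]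
      (fun μ => ∫ x, f x μ ∂(pointKernel lam μ)) ∘ η :=
    hη.ae_cellFinite.mono fun ω hω => scoreSum_eq hω
  have hsm := stronglyMeasurable_integral_score (lam := lam) hf
  have hL2' : MemLp (fun μ => ∫ x, f x μ ∂(pointKernel lam μ)) 2 (P.map η) :=
    (memLp_map_measure_iff hsm.aestronglyMeasurable hm.aemeasurable).2 ((memLp_congr_ae hF).1 hL2)
  have hprod' := integrable_scoreProduct_map hm hf hprod
  have hsq := hQ.integrable_sq hf hconv' hL2' hprod'
  have hi := (hQ.integrable_pairProduct_iff hf).2 ⟨hsq, hprod'⟩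
  have hvar := hQ.variance_eq hf hconv' hL2' hprod'
  have hmom : scoreSecondMoment P η lam f =
      ENNReal.ofReal (∫ p, f p.2 (p.1.add p.2) ^ 2 ∂((P.map η).prod lam)) := by
    rw [scoreSecondMoment_eq hm hf,
      ofReal_integral_eq_lintegral_ofReal hsq (ae_of_all _ fun p => sq_nonneg _)]
  refine ⟨by rw [hmom]; exact ENNReal.ofReal_ne_top, ?_⟩
  have hev : evariance (fun ω => scoreSum f (η ω)) P =
      ENNReal.ofReal (variance (fun μ => ∫ x, f x μ ∂(pointKernel lam μ)) (P.map η)) := by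
    rw [← hL2.ofReal_variance_eq, variance_congr hF,
      variance_map hsm.aestronglyMeasurable.aemeasurable hm.aemeasurable]
  rw [hev, hvar, ← pairTerm_eq hm hf hprod' (hQ.integrable_score_add hf hi)]
  refine ENNReal.ofReal_add_le.trans ?_
  rw [← hmom, ENNReal.ofReal_add zero_le_one hC, add_mul, ENNReal.ofReal_one, one_mul]
  gcongr

end

/-! ### Add-one costs -/

section

variable {Ω X : Type*} [MeasurableSpace Ω] [MeasurableSpace X] {lam : Measure X}
  [SigmaFinite lam] {P : Measure Ω} [IsProbabilityMeasure P] {η : Ω → Config X}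
  {f : X → Config X → ℝ}

lemma measurable_score_right (hf : Measurable (Function.uncurry f)) (μ : Config X) :
    Measurable fun x => f x μ :=
  hf.comp measurable_prodMk_right

/-- The add-one cost of a sum of scores is the score of the added point plus the change of the
scores of the other points. -/
lemma addOneCost_scoreSum (hf : Measurable (Function.uncurry f)) {μ : Config X} {y : X}
    (h : Integrable (fun x => f x μ) μ.toMeasure)
    (hy : Integrable (fun x => f x (μ.add y)) (μ.add y).toMeasure) :
    addOneCost (scoreSum f) y μ =
      f y (μ.add y) + sumOver μ (fun x => addOneCost (f x) y μ) := by
  rw [Config.toMeasure_add, integrable_add_measure] at hy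
  have h1 : scoreSum f (μ.add y) = ∫ x, f x (μ.add y) ∂μ.toMeasure + f y (μ.add y) := by
    rw [scoreSum, sumOver, Config.toMeasure_add, integral_add_measure hy.1 hy.2,
      integral_dirac' _ _ (measurable_score_right hf _).stronglyMeasurable]
  have h2 : sumOver μ (fun x => addOneCost (f x) y μ) =
      ∫ x, f x (μ.add y) ∂μ.toMeasure - scoreSum f μ := integral_sub hy.1 h
  rw [addOneCost, h1, h2]
  ring

omit [IsProbabilityMeasure P] in
lemma lintegral_ofReal_sq (g : Ω → ℝ) :
    ∫⁻ ω, ENNReal.ofReal (g ω ^ 2) ∂P = eLpNorm g 2 P ^ 2 := by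
  have := eLpNorm_nnreal_pow_eq_lintegral (f := g) (p := 2) (μ := P) two_ne_zero
  simp only [NNReal.coe_ofNat, ENNReal.coe_ofNat, ENNReal.rpow_ofNat] at this
  rw [this]
  congr 1 with ω
  rw [← sq_abs, ENNReal.ofReal_pow (abs_nonneg _), Real.enorm_eq_ofReal_abs]

/-- Solving `a ≤ √e (d + a)` for `a`, which needs `a` to be finite. -/
lemma sq_le_of_sq_le_mul_sq {a b d : ℝ≥0∞} {e : ℝ} (ha : a ≠ ∞) (he0 : 0 ≤ e) (he1 : e < 1)
    (hab : a ^ 2 ≤ ENNReal.ofReal e * b ^ 2) (hb : b ≤ d + a) :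
    a ^ 2 ≤ ENNReal.ofReal (e / (1 - √e) ^ 2) * d ^ 2 := by
  have hs : √e < 1 := by rw [Real.sqrt_lt' one_pos]; simpa using he1
  rcases he0.eq_or_lt with rfl | hpos
  · simpa using hab
  have hr : 0 < e / (1 - √e) ^ 2 := div_pos hpos (pow_pos (sub_pos.2 hs) 2)
  -- Finiteness of `a` matters here: `b = ∞` forces `d = ∞`.
  rcases eq_or_ne d ∞ with rfl | hd
  · simp [ENNReal.mul_top, hr]
  lift a to NNReal using ha
  lift d to NNReal using hd
  lift b to NNReal using ne_top_of_le_ne_top (by finiteness) hb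
  have hb' : (b : ℝ) ≤ d + a := by exact_mod_cast hb
  have hab' : (a : ℝ) ^ 2 ≤ e * b ^ 2 := by
    have := ENNReal.toReal_mono (by finiteness) hab
    simpa [ENNReal.toReal_mul, he0] using this
  have h1 : (a : ℝ) ≤ √e * b := by
    refine (pow_le_pow_iff_left₀ a.coe_nonneg (by positivity) two_ne_zero).1 ?_
    rwa [mul_pow, Real.sq_sqrt he0]
  have h2 : (1 - √e) * a ≤ √e * d := by nlinarith [Real.sqrt_nonneg e]
  have h3 : (a : ℝ) ^ 2 ≤ e / (1 - √e) ^ 2 * d ^ 2 := by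
    have h4 : ((1 - √e) * a) ^ 2 ≤ (√e * d) ^ 2 :=
      pow_le_pow_left₀ (mul_nonneg (sub_pos.2 hs).le a.2) h2 2
    rw [mul_pow, mul_pow, Real.sq_sqrt he0] at h4
    rw [div_mul_eq_mul_div, le_div_iff₀ (pow_pos (sub_pos.2 hs) 2)]
    linarith
  have := ENNReal.ofReal_le_ofReal h3
  rw [ENNReal.ofReal_mul hr.le, ENNReal.ofReal_pow a.coe_nonneg,
    ENNReal.ofReal_pow d.coe_nonneg] at this
  simpa using this

/-- The second moment of the scores is bounded by the second moment of the add-one costs, if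
each score is small compared to the effect of the added point on the other scores. -/
theorem IsPoissonProcess.scoreSecondMoment_le (hη : IsPoissonProcess P η lam)
    (hf : Measurable (Function.uncurry f))
    (hconv : ∀ᵐ ω ∂P, Integrable (fun x => f x (η ω)) (η ω).toMeasure)
    (hfin : scoreSecondMoment P η lam f ≠ ∞) {e : ℝ} (he0 : 0 ≤ e) (he1 : e < 1)
    (hle : ∀ᵐ y ∂lam, ∫⁻ ω, ENNReal.ofReal ((f y ((η ω).add y)) ^ 2) ∂P ≤
      ENNReal.ofReal e *
        ∫⁻ ω, ENNReal.ofReal ((sumOver (η ω) (fun x => addOneCost (f x) y (η ω))) ^ 2) ∂P) :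
    scoreSecondMoment P η lam f ≤ ENNReal.ofReal (e / (1 - √e) ^ 2) *
      ∫⁻ ω, ∫⁻ x, ENNReal.ofReal ((addOneCost (scoreSum f) x (η ω)) ^ 2) ∂lam ∂P := by
  have hm := hη.measurable
  have : IsProbabilityMeasure (P.map η) := Measure.isProbabilityMeasure_map hm.aemeasurable
  have hQ := hη.satisfiesMecke
  have hconv' := hη.ae_integrable_pointKernel hf hconv
  have hnice := hη.ae_cellFinite
  have hadd : Measurable fun p : Ω × X => ((η p.1).add p.2) :=
    Config.measurable_add.comp (hm.prodMap measurable_id)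
  have hφ : Measurable fun p : Ω × X => f p.2 ((η p.1).add p.2) :=
    hf.comp (measurable_snd.prodMk hadd)
  -- The add-one cost need not be measurable, but it agrees with the jointly measurable
  -- function `G`, outside of a null set of `ω` that does not depend on the added point.
  let F : Config X → ℝ := fun μ => ∫ x, f x μ ∂(pointKernel lam μ)
  have hFm : Measurable F := (stronglyMeasurable_integral_score hf).measurable
  let G : Ω × X → ℝ := fun p => F ((η p.1).add p.2) - F (η p.1)
  have hG : Measurable G := (hFm.comp hadd).sub (hFm.comp (hm.comp measurable_fst))
  have hGeq : ∀ᵐ ω ∂P, ∀ y, addOneCost (scoreSum f) y (η ω) = G (ω, y) := by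
    filter_upwards [hnice] with ω hω y
    rw [addOneCost, scoreSum_eq hω, scoreSum_eq (Config.add_mem_cellFinite hω y)]
  have hconvadd : ∀ᵐ y ∂lam, ∀ᵐ ω ∂P,
      Integrable (fun x => f x ((η ω).add y)) ((η ω).add y).toMeasure := by
    have h1 := hQ.ae_add (measurableSet_kernel_integrable (f := fun μ x => f x μ)
      (hf.comp measurable_swap).stronglyMeasurable) hconv'
    have h2 : ∀ᵐ q ∂(lam.prod (P.map η)), Integrable (fun x => f x (q.2.add q.1))
        (pointKernel lam (q.2.add q.1)) := by
      rw [← Measure.prod_swap] at h1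
      exact ae_of_ae_map measurable_swap.aemeasurable h1
    filter_upwards [Measure.ae_ae_of_ae_prod h2] with y hy
    filter_upwards [ae_of_ae_map hm.aemeasurable hy, hnice] with ω hω h3
    rwa [pointKernel_apply (Config.add_mem_cellFinite h3 y)] at hω
  have hφfin : ∀ᵐ y ∂lam, ∫⁻ ω, ENNReal.ofReal ((f y ((η ω).add y)) ^ 2) ∂P < ∞ :=
    ae_lt_top (Measurable.lintegral_prod_left'
      (f := fun p : Ω × X => ENNReal.ofReal (f p.2 ((η p.1).add p.2) ^ 2))
      (hφ.pow_const 2).ennreal_ofReal) hfin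
  have key : ∀ᵐ y ∂lam, ∫⁻ ω, ENNReal.ofReal ((f y ((η ω).add y)) ^ 2) ∂P ≤
      ENNReal.ofReal (e / (1 - √e) ^ 2) * ∫⁻ ω, ENNReal.ofReal (G (ω, y) ^ 2) ∂P := by
    filter_upwards [hle, hconvadd, hφfin] with y h1 h2 h3
    rw [lintegral_ofReal_sq] at h1 h3 ⊢
    rw [lintegral_ofReal_sq] at h1 ⊢
    refine sq_le_of_sq_le_mul_sq ?_ he0 he1 h1 ?_
    · intro h
      simp [h] at h3
    · have hS : (fun ω => sumOver (η ω) (fun x => addOneCost (f x) y (η ω))) =ᵐ[P]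
          (fun ω => G (ω, y)) - fun ω => f y ((η ω).add y) := by
        filter_upwards [hGeq, h2, hconv] with ω h4 h5 h6
        rw [Pi.sub_apply, ← h4 y, addOneCost_scoreSum hf h6 h5, add_sub_cancel_left]
      rw [eLpNorm_congr_ae hS]
      exact eLpNorm_sub_le (hG.comp measurable_prodMk_right).aestronglyMeasurable
        (hφ.comp measurable_prodMk_right).aestronglyMeasurable one_le_two
  calc scoreSecondMoment P η lam f
      ≤ ∫⁻ y, ENNReal.ofReal (e / (1 - √e) ^ 2) *
          ∫⁻ ω, ENNReal.ofReal (G (ω, y) ^ 2) ∂P ∂lam := lintegral_mono_ae key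
    _ = ENNReal.ofReal (e / (1 - √e) ^ 2) *
          ∫⁻ ω, ∫⁻ y, ENNReal.ofReal (G (ω, y) ^ 2) ∂lam ∂P := by
        rw [lintegral_const_mul' _ _ ENNReal.ofReal_ne_top, lintegral_lintegral_swap]
        exact (((hG.comp measurable_swap).pow_const 2).ennreal_ofReal).aemeasurable
    _ = _ := by
        congr 1
        refine lintegral_congr_ae (hGeq.mono fun ω hω => ?_)
        simp only [hω]

end

end PoissonScores

theorem proposition2p12 {Ω X : Type*} [MeasurableSpace Ω] [MeasurableSpace X]
    [StandardBorelSpace X] (P : Measure Ω) [IsProbabilityMeasure P]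
    (lam : ℝ → Measure X) (hlam : ∀ s : ℝ, 0 < s → SigmaFinite (lam s))
    (η : ℝ → Ω → PoissonScores.Config X)
    (hη : ∀ s : ℝ, 0 < s → PoissonScores.IsPoissonProcess P (η s) (lam s))
    (f : ℝ → X → PoissonScores.Config X → ℝ)
    (hf : ∀ s : ℝ, 0 < s → Measurable (Function.uncurry (f s)))
    (hconv : ∀ s : ℝ, 0 < s → ∀ᵐ ω ∂P,
      Integrable (fun x => f s x (η s ω)) (η s ω).toMeasure)
    (hL2 : ∀ s : ℝ, 0 < s →
      MemLp (fun ω => PoissonScores.scoreSum (f s) (η s ω)) 2 P)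
    (C : ℝ) (hA1 : PoissonScores.AssumptionA1 P η lam f C) :
    (∃ K : ℝ, 0 < K ∧ ∀ s : ℝ, 0 < s →
      evariance (fun ω => PoissonScores.scoreSum (f s) (η s ω)) P ≤
        ENNReal.ofReal K * PoissonScores.scoreSecondMoment P (η s) (lam s) (f s)) ∧
    ∀ ε : ℝ → ℝ, PoissonScores.AssumptionA2 P η lam f ε →
      PoissonScores.IsSuperconcentrated P η lam (fun s => PoissonScores.scoreSum (f s))
        {s : ℝ | 0 < s ∧ ε s < 1}
        (fun s => (1 + C) * ε s / (1 - √(ε s)) ^ 2) := by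
  have hC : 0 < 1 + C := by linarith [hA1.pos]
  have hbound (s : ℝ) (hs : 0 < s) :
      PoissonScores.scoreSecondMoment P (η s) (lam s) (f s) ≠ ∞ ∧
      evariance (fun ω => PoissonScores.scoreSum (f s) (η s ω)) P ≤
        ENNReal.ofReal (1 + C) * PoissonScores.scoreSecondMoment P (η s) (lam s) (f s) := by
    have := hlam s hs
    exact (hη s hs).evariance_scoreSum_le (hf s hs) (hconv s hs) (hL2 s hs)
      (hA1.integrable s hs) hA1.pos.le (hA1.le s hs)
  refine ⟨⟨1 + C, hC, fun s hs => (hbound s hs).2⟩, fun ε hA2 => ⟨?_, ?_, ?_, ?_⟩⟩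
  · filter_upwards [eventually_gt_atTop 0, hA2.tendsto.eventually_lt_const one_pos] with s h1 h2
    exact ⟨h1, h2⟩
  · exact fun s hs => hL2 s hs.1
  · have h1 : Tendsto (fun t : ℝ => (1 + C) * t / (1 - √t) ^ 2) (𝓝 0) (𝓝 0) := by
      have : ContinuousAt (fun t : ℝ => (1 + C) * t / (1 - √t) ^ 2) 0 := by
        refine ContinuousAt.div (by fun_prop) (by fun_prop) (by simp)
      simpa [ContinuousAt] using this
    exact h1.comp hA2.tendsto
  · rintro s ⟨hs, hε⟩
    have := hlam s hs
    have h1 := (hη s hs).scoreSecondMoment_le (hf s hs) (hconv s hs) (hbound s hs).1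
      (hA2.nonneg s hs) hε (hA2.le s hs)
    refine (hbound s hs).2.trans ((mul_le_mul_right h1 _).trans_eq ?_)
    rw [← mul_assoc, ← ENNReal.ofReal_mul hC.le, mul_div_assoc]
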